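/- Fix an integer $m\ge 1$. Let $G_1^{(1)}$ be the directed graph with one vertex $v_1$ and one loop, and for $t\ge 2$ obtain $G_1^{(t)}$ from $G_1^{(t-1)}$ by adding a vertex $v_t$ and one directed edge from $v_t$ to a random vertex $v_i$, where, given $G_1^{(t-1)}$, $\Pr[i=s]=\deg_{G_1^{(t-1)}}(v_s)/(2t-1)$ for $1\le s\le t-1$ and $\Pr[i=t]=1/(2t-1)$; here $\deg$ is the total degree, a loop counting twice. Let $G_m^{(n)}$ be obtained from $G_1^{(mn)}$ by identifying the vertices $v_1,\dots,v_m$ to one vertex, $v_{m+1},\dots,v_{2m}$ to a second one, and so on, keeping all edges (loops and multiple edges included). Let $N(n,m,d)$ be the number of vertices of $G_m^{(n)}$ with in-degree $d$ (edges counted with multiplicity, a loop adding $1$ to the in-degree). Then, for $d$ up to $n^{1/14-\epsilon}$, the proportion $N(n,m,d)/n$ follows the power law $d^{-3}$ with probability tending to $1$. That is: (i) There are constants $0<c\le C$ depending only on $m$ such that for every $\epsilon>0$, $$\Pr\Big[\,\frac{c}{d^3}\le \frac{N(n,m,d)}{n}\le \frac{C}{d^3}\ \text{ for all integers } d \text{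 with } 1\le d\le n^{1/14-\epsilon}\Big]\to 1\qquad (n\to\infty).$$ (ii) More precisely, for every $\epsilon>0$ and every $\delta>0$, $$\Pr\Big[\,\Big|\frac{N(n,m,d)}{n}-\alpha_{m,d}\Big|\le \delta\,\alpha_{m,d}\ \text{ for all integers } d \text{ with } 1\le d\le n^{1/14-\epsilon}\Big]\to 1\qquad (n\to\infty),$$ where $$\alpha_{m,d}=\frac{2m(m+1)}{(d+m)(d+m+1)(d+m+2)},$$ so that $\alpha_{m,d}\sim 2m(m+1)/d^3$ as $d\to\infty$. -/

import Mathlib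

open Filter Topology
open scoped ENNReal

/-- A finite directed multigraph with `n` vertices and `k` directed edges; edge `e` goes from
`src e` to `tgt e`. Loops and multiple edges are allowed. -/
structure Multidigraph (n k : ℕ) where
  src : Fin k → Fin n
  tgt : Fin k → Fin n

namespace Multidigraph

/-- Every set of multigraphs is an event. -/
instance (n k : ℕ) : MeasurableSpace (Multidigraph n k) := ⊤

/-- In-degree, counted with multiplicity; a loop contributes `1`. -/
def inDegree {n k : ℕ} (G : Multidigraph n k) (v : Fin n) : ℕ :=
  (Finset.univ.filter fun e : Fin k => G.tgt e = v).card

/-- Out-degree, counted with multiplicity; a loop contributes `1`. -/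
def outDegree {n k : ℕ} (G : Multidigraph n k) (v : Fin n) : ℕ :=
  (Finset.univ.filter fun e : Fin k => G.src e = v).card

/-- Total degree; a loop contributes `2`. -/
def degree {n k : ℕ} (G : Multidigraph n k) (v : Fin n) : ℕ :=
  G.inDegree v + G.outDegree v

theorem sum_degree {n k : ℕ} (G : Multidigraph n k) : ∑ v, G.degree v = 2 * k := by
  have h (f : Fin k → Fin n) :
      ∑ v, (Finset.univ.filter fun e : Fin k => f e = v).card = k := by
    have := Finset.card_eq_sum_card_fiberwise (f := f) (s := Finset.univ) (t := Finset.univ)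
      (fun _ _ => Finset.mem_coe.2 (Finset.mem_univ _))
    simpa using this.symm
  simp only [degree, inDegree, outDegree, Finset.sum_add_distrib, h]
  omega

/-- Add a new last vertex and one directed edge from it to the vertex `i` (possibly itself). -/
def addVertex {n k : ℕ} (G : Multidigraph n k) (i : Fin (n + 1)) :
    Multidigraph (n + 1) (k + 1) where
  src := Fin.snoc (α := fun _ => Fin (n + 1)) (fun e => (G.src e).castSucc) (Fin.last n)
  tgt := Fin.snoc (α := fun _ => Fin (n + 1)) (fun e => (G.tgt e).castSucc) i

/-- Identify the first `m` vertices to one vertex, the next `m` vertices to a second one, and so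
on, keeping all edges: the (0-based) vertex `i` is sent to `⌊i / m⌋`. -/
def collapse {n m k : ℕ} (G : Multidigraph (n * m) k) : Multidigraph n k where
  src := fun e => (G.src e).divNat
  tgt := fun e => (G.tgt e).divNat

/-- The number of vertices with in-degree `d`. -/
def numInDegree {n k : ℕ} (G : Multidigraph n k) (d : ℕ) : ℕ :=
  (Finset.univ.filter fun v : Fin n => G.inDegree v = d).card

end Multidigraph

noncomputable section

/-- The probability that the `t`-th vertex, where `t = n + 1`, sends its edge to vertex `i`: it is
`1 / (2 t - 1)` for the new vertex itself and `degree / (2 t - 1)` for an older vertex. -/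
def attachWeight {n : ℕ} (G : Multidigraph n n) (i : Fin (n + 1)) : ℝ≥0∞ :=
  Fin.lastCases (motive := fun _ => ℝ≥0∞) (1 / (2 * n + 1 : ℕ))
    (fun s => (G.degree s : ℝ≥0∞) / (2 * n + 1 : ℕ)) i

theorem sum_attachWeight {n : ℕ} (G : Multidigraph n n) : ∑ i, attachWeight G i = 1 := by
  have h : ∑ s, (G.degree s : ℝ≥0∞) = (2 * n : ℕ) := by
    rw [← G.sum_degree]; push_cast; rfl
  rw [Fin.sum_univ_castSucc]
  simp only [attachWeight, Fin.lastCases_castSucc, Fin.lastCases_last]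
  simp only [div_eq_mul_inv, ← Finset.sum_mul, h]
  rw [← add_mul, ← Nat.cast_one (R := ℝ≥0∞), ← Nat.cast_add]
  rw [ENNReal.mul_inv_cancel (Nat.cast_ne_zero.2 (Nat.succ_ne_zero (2 * n))) (ENNReal.natCast_ne_top _)]
  simp

/-- The law of the vertex chosen by the new vertex, given the current graph. -/
def attachLaw {n : ℕ} (G : Multidigraph n n) : PMF (Fin (n + 1)) :=
  PMF.ofFintype (attachWeight G) (sum_attachWeight G)

/-- The law of the one-connection preferential attachment graph on `n` vertices. The first step
gives one vertex with one loop. -/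
def prefAttachOne : (n : ℕ) → PMF (Multidigraph n n)
  | 0 => PMF.pure ⟨Fin.elim0, Fin.elim0⟩
  | n + 1 => (prefAttachOne n).bind fun G => (attachLaw G).map G.addVertex

/-- The law of the preferential attachment graph on `n` vertices with `m` connections per
vertex. -/
def prefAttach (m n : ℕ) : PMF (Multidigraph n (n * m)) :=
  (prefAttachOne (n * m)).map Multidigraph.collapse

/-- The limiting proportion of vertices of in-degree `d`; it is `~ 2 m (m + 1) / d ^ 3` as
`d → ∞`. -/
def limitProportion (m d : ℕ) : ℝ :=
  2 * m * (m + 1) / ((d + m) * (d + m + 1) * (d + m + 2))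

end

/-!
The proof is a second moment computation followed by Chebyshev's inequality and a union bound.

Put `T = n m`, and fix the target degree `d`. Call the sets of `m` consecutive vertices of the
one-connection graph groups; the in-degree `j` of a group increases at the step from `t` to `t + 1`
with probability `(j + m) / (2 t + 1)`, unless the group is unfinished at that time. Solving the
corresponding backward equation from the indicator of `d` at time `T` gives functions `φ_t`
(`backward`), with values in `[0, 1]` for `t ≥ d + m`. The sum of `φ_t` over the groups then has
almost no drift apart from the arrival of new groups, and at time `T` it is the number of groups of in-degree `d`. The limiting
proportions `α` satisfy `(d + m + 2) α_d = (d + m - 1) α_{d - 1}`, the stationary form of the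
forward equation, so that `t / m * ∑ α_j φ_t j` grows in the same way, up to small errors. The difference of the two quantities is `degreeDeviation`.

In the drift of this difference all main terms cancel and boundary terms of order `1 / t` remain
(`drift_eq`). The difference itself is at most `2 t` and its increments are bounded, so its second
moment grows by at most a constant per step (`sum_attachWeight_mul_degreeDeviation_sq_le`). Hence
`E (N(n, m, d) - n α_d)² ≤ 4 (d + m)² + O(n)` (`secondMoment_final_le`), where the first term bounds
the times before `d + m`. As `α_d` is of order `d⁻³`, a relative error `δ` at a given `d` has
probability `O(d⁶ / n)`. Summed over `d ≤ D` this is `O(D⁷ / n)`, which is `O(n ^ (-1/2))` for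
`D ≤ n ^ (1/14)`. Part (i) follows from part (ii) with `δ = 1 / 2`, since `α_d` is bounded above
and below by multiples of `d⁻³`.
-/

/-! ### Degrees of groups of vertices -/

namespace Multidigraph

/-- The in-degree of the `g`-th group of `m` consecutive vertices, which is the in-degree of
vertex `g` after collapsing. The index `g` runs over all of `ℕ`, so that groups whose vertices have
not been added yet are included, with in-degree `0`. -/
def groupInDegree {n k : ℕ} (m : ℕ) (G : Multidigraph n k) (g : ℕ) : ℕ :=
  (Finset.univ.filter fun e : Fin k => (G.tgt e : ℕ) / m = g).card

theorem inDegree_collapse {n m k : ℕ} (G : Multidigraph (n * m) k) (v : Fin n) :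
    G.collapse.inDegree v = G.groupInDegree m v := by
  unfold inDegree groupInDegree collapse
  congr 1
  ext e
  simp [Fin.ext_iff]

theorem groupInDegree_addVertex {n k : ℕ} (m : ℕ) (G : Multidigraph n k) (i : Fin (n + 1))
    (g : ℕ) :
    (G.addVertex i).groupInDegree m g = G.groupInDegree m g + if (i : ℕ) / m = g then 1 else 0 := by
  unfold groupInDegree addVertex
  simp only [Finset.card_filter]
  rw [Fin.sum_univ_castSucc]
  simp

/-- Summing over edges is summing over groups, weighted by in-degree. -/
theorem sum_groupInDegree_mul {t n m : ℕ} (G : Multidigraph t t) (ht : t ≤ n * m) (F : ℕ → ℝ) :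
    ∑ g ∈ Finset.range n, (G.groupInDegree m g : ℝ) * F g
      = ∑ e : Fin t, F ((G.tgt e : ℕ) / m) := by
  have hmaps : ∀ e ∈ (Finset.univ : Finset (Fin t)),
      (G.tgt e : ℕ) / m ∈ Finset.range n := fun e _ =>
    Finset.mem_range.2 (Nat.div_lt_of_lt_mul (by
      have := (G.tgt e).2
      rw [mul_comm]; omega))
  rw [← Finset.sum_fiberwise_of_maps_to hmaps]
  refine Finset.sum_congr rfl fun g _ => ?_
  rw [Finset.sum_congr rfl (g := fun _ => F g)]
  · simp [groupInDegree]
  · intro e he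
    rw [(Finset.mem_filter.1 he).2]

theorem groupInDegree_eq_zero {t m g : ℕ} (G : Multidigraph t t) (hg : t / m < g) :
    G.groupInDegree m g = 0 := by
  unfold groupInDegree
  rw [Finset.card_eq_zero, Finset.filter_eq_empty_iff]
  intro e _ he
  have : (G.tgt e : ℕ) / m ≤ t / m := Nat.div_le_div_right (G.tgt e).2.le
  omega

end Multidigraph

/-- Almost surely, the `e`-th edge starts at the `e`-th vertex. -/
theorem src_of_mem_support_prefAttachOne (n : ℕ) :
    ∀ G ∈ (prefAttachOne n).support, ∀ e, G.src e = e := by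
  induction n with
  | zero => exact fun G _ e => e.elim0
  | succ n ih =>
    intro G hG e
    simp only [prefAttachOne, PMF.mem_support_bind_iff, PMF.mem_support_map_iff] at hG
    obtain ⟨G', hG', i, _, rfl⟩ := hG
    refine Fin.lastCases ?_ (fun e => ?_) e
    · simp [Multidigraph.addVertex]
    · simp [Multidigraph.addVertex, ih G' hG' e]

theorem attachWeight_toReal {t : ℕ} (G : Multidigraph t t) (hG : ∀ e, G.src e = e)
    (i : Fin (t + 1)) :
    (attachWeight G i).toReal
      = ((∑ e : Fin t, if (G.tgt e : ℕ) = i then (1 : ℝ) else 0) + 1) / (2 * t + 1) := by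
  refine Fin.lastCases ?_ (fun s => ?_) i
  · have : ∀ e : Fin t, (G.tgt e : ℕ) ≠ t := fun e => (G.tgt e).2.ne
    simp only [attachWeight, Fin.lastCases_last, Fin.val_last, if_neg (this _),
      ENNReal.toReal_div, ENNReal.toReal_natCast]
    simp
  · have hout : G.outDegree s = 1 := by
      simp [Multidigraph.outDegree, hG, Finset.filter_eq']
    simp only [attachWeight, Fin.lastCases_castSucc, ENNReal.toReal_div, ENNReal.toReal_natCast,
      Multidigraph.degree, hout, Fin.val_castSucc]
    simp [Multidigraph.inDegree, Fin.ext_iff]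

theorem sum_attachWeight_toReal {t : ℕ} (G : Multidigraph t t) :
    ∑ i, (attachWeight G i).toReal = 1 := by
  rw [← ENNReal.toReal_sum, sum_attachWeight, ENNReal.toReal_one]
  intro i _ h
  have := Finset.single_le_sum (f := attachWeight G) (fun _ _ => zero_le) (Finset.mem_univ i)
  rw [h, sum_attachWeight] at this
  simp at this

theorem sum_attachWeight_mul {t : ℕ} (m : ℕ) (G : Multidigraph t t) (hG : ∀ e, G.src e = e)
    (F : ℕ → ℝ) :
    ∑ i : Fin (t + 1), (attachWeight G i).toReal * F ((i : ℕ) / m)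
      = (∑ e : Fin t, F ((G.tgt e : ℕ) / m) + ∑ i ∈ Finset.range (t + 1), F (i / m))
          / (2 * t + 1) := by
  simp only [attachWeight_toReal G hG, div_mul_eq_mul_div, ← Finset.sum_div, add_mul, one_mul,
    Finset.sum_add_distrib, Finset.sum_mul]
  rw [Finset.sum_comm, Finset.sum_range]
  congr 2
  refine Finset.sum_congr rfl fun e _ => ?_
  rw [Finset.sum_eq_single (G.tgt e).castSucc]
  · simp
  · intro i _ hi
    rw [if_neg, zero_mul]
    intro h
    exact hi (Fin.ext h.symm)
  · simp

/-! ### The limiting proportions -/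

theorem limitProportion_nonneg (m d : ℕ) : 0 ≤ limitProportion m d := by
  unfold limitProportion; positivity

theorem sum_limitProportion {m : ℕ} (hm : 1 ≤ m) (d : ℕ) :
    ∑ j ∈ Finset.range d, limitProportion m j = 1 - m * (m + 1) / ((d + m) * (d + m + 1)) := by
  have hm' : (0 : ℝ) < m := by exact_mod_cast hm
  induction d with
  | zero => simp; field_simp; norm_num
  | succ d ih =>
    rw [Finset.sum_range_succ, ih, limitProportion]
    push_cast
    field_simp
    ring

theorem sum_limitProportion_le_one {m : ℕ} (hm : 1 ≤ m) (d : ℕ) :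
    ∑ j ∈ Finset.range d, limitProportion m j ≤ 1 := by
  rw [sum_limitProportion hm, sub_le_self_iff]
  positivity

/-- The recurrence that characterizes the limiting proportions, in a form dual to the evolution of
the degree counts. -/
theorem sum_limitProportion_mul_diff {m : ℕ} (hm : 1 ≤ m) (d : ℕ) (f : ℕ → ℝ) :
    ∑ j ∈ Finset.range d, limitProportion m j * ((j + m) * (f (j + 1) - f j))
      = 2 * ∑ j ∈ Finset.range d, limitProportion m j * f j - 2 * f 0
        + limitProportion m d * (d + m + 2) * f d := by
  have hm' : (0 : ℝ) < m := by exact_mod_cast hm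
  induction d with
  | zero =>
    simp [limitProportion]
    field_simp
    ring
  | succ d ih =>
    rw [Finset.sum_range_succ, Finset.sum_range_succ, ih]
    have : limitProportion m (d + 1) * ((d + 1 : ℕ) + m + 2) = limitProportion m d * (d + m) := by
      unfold limitProportion
      push_cast
      field_simp
      ring
    rw [this]
    ring

theorem limitProportion_le (m : ℕ) {d : ℕ} (hd : 1 ≤ d) :
    limitProportion m d ≤ 2 * m * (m + 1) * (1 / (d : ℝ) ^ 3) := by
  have hd' : (0 : ℝ) < d := by exact_mod_cast hd
  rw [limitProportion, mul_one_div]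
  gcongr
  calc (d : ℝ) ^ 3 = d * d * d := by ring
    _ ≤ _ := by gcongr <;> linarith [(Nat.cast_nonneg m : (0 : ℝ) ≤ m)]

theorem le_limitProportion {m : ℕ} (hm : 1 ≤ m) {d : ℕ} (hd : 1 ≤ d) :
    2 * m / ((m + 2) * (m + 3)) * (1 / (d : ℝ) ^ 3) ≤ limitProportion m d := by
  have hd' : (1 : ℝ) ≤ d := by exact_mod_cast hd
  have hm' : (0 : ℝ) < m := by exact_mod_cast hm
  calc 2 * m / ((m + 2) * (m + 3)) * (1 / (d : ℝ) ^ 3)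
      = 2 * m * (m + 1) / (((m + 1) * d) * ((m + 2) * d) * ((m + 3) * d)) := by field_simp
    _ ≤ _ := by
      rw [limitProportion]
      gcongr <;> nlinarith

/-! ### The deviation of the degree counts -/

/-- For a function `φ` of the in-degree, the sum of `φ - φ 0` over the first `n` groups of a graph
on `t` vertices, minus the value `t / m * (∑ j ≤ d, α_j φ j - φ 0)` that the limiting proportions
`α` predict for the `t / m` groups present. Subtracting `φ 0` makes the groups that have not been
started drop out. -/
noncomputable def degreeDeviation (m n d : ℕ) (φ : ℕ → ℝ) {t : ℕ} (G : Multidigraph t t) : ℝ :=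
  ∑ g ∈ Finset.range n, (φ (G.groupInDegree m g) - φ 0)
    + t / m * (φ 0 - ∑ j ∈ Finset.range (d + 1), limitProportion m j * φ j)

theorem sum_limitProportion_mul_mem_Icc {m : ℕ} (hm : 1 ≤ m) (d : ℕ) {φ : ℕ → ℝ}
    (hφ : ∀ j, φ j ∈ Set.Icc (0 : ℝ) 1) :
    ∑ j ∈ Finset.range d, limitProportion m j * φ j ∈ Set.Icc (0 : ℝ) 1 :=
  ⟨Finset.sum_nonneg fun j _ => mul_nonneg (limitProportion_nonneg m j) (hφ j).1,
    (Finset.sum_le_sum fun j _ =>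
      mul_le_of_le_one_right (limitProportion_nonneg m j) (hφ j).2).trans
      (sum_limitProportion_le_one hm d)⟩

theorem abs_degreeDeviation_le {m n d t : ℕ} (hm : 1 ≤ m) (ht : t ≤ n * m) {φ : ℕ → ℝ}
    (hφ : ∀ j, φ j ∈ Set.Icc (0 : ℝ) 1) (G : Multidigraph t t) :
    |degreeDeviation m n d φ G| ≤ 2 * t := by
  have hm' : (1 : ℝ) ≤ m := by exact_mod_cast hm
  have h1 : |∑ g ∈ Finset.range n, (φ (G.groupInDegree m g) - φ 0)| ≤ t := by
    calc |∑ g ∈ Finset.range n, (φ (G.groupInDegree m g) - φ 0)|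
        ≤ ∑ g ∈ Finset.range n, |φ (G.groupInDegree m g) - φ 0| := Finset.abs_sum_le_sum_abs _ _
      _ ≤ ∑ g ∈ Finset.range n, (G.groupInDegree m g : ℝ) * 1 := by
        refine Finset.sum_le_sum fun g _ => ?_
        rcases Nat.eq_zero_or_pos (G.groupInDegree m g) with h | h
        · simp [h]
        · have h' : (1 : ℝ) ≤ G.groupInDegree m g := by exact_mod_cast h
          rw [abs_le]
          constructor <;> linarith [(hφ (G.groupInDegree m g)).1, (hφ (G.groupInDegree m g)).2,
            (hφ 0).1, (hφ 0).2]
      _ = t := by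
        rw [G.sum_groupInDegree_mul ht fun _ => 1]
        simp
  have h2 : |(t : ℝ) / m * (φ 0 - ∑ j ∈ Finset.range (d + 1), limitProportion m j * φ j)|
      ≤ t := by
    have hS := sum_limitProportion_mul_mem_Icc hm (d + 1) hφ
    rw [abs_mul, abs_of_nonneg (by positivity : (0 : ℝ) ≤ t / m)]
    calc (t : ℝ) / m * |φ 0 - ∑ j ∈ Finset.range (d + 1), limitProportion m j * φ j|
        ≤ t * 1 := by
          refine mul_le_mul (div_le_self (Nat.cast_nonneg t) hm') ?_ (abs_nonneg _)
            (Nat.cast_nonneg t)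
          rw [abs_le]
          constructor <;> linarith [hS.1, hS.2, (hφ 0).1, (hφ 0).2]
      _ = t := mul_one _
  calc |degreeDeviation m n d φ G| ≤ t + t := (abs_add_le _ _).trans (add_le_add h1 h2)
    _ = 2 * t := by ring

theorem degreeDeviation_addVertex {m n d t : ℕ} (ht : t < n * m) (φ : ℕ → ℝ)
    (G : Multidigraph t t) (i : Fin (t + 1)) :
    degreeDeviation m n d φ (G.addVertex i)
      = (∑ g ∈ Finset.range n, (φ (G.groupInDegree m g) - φ 0)
        + ((t : ℝ) + 1) / m * (φ 0 - ∑ j ∈ Finset.range (d + 1), limitProportion m j * φ j))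
        + (φ (G.groupInDegree m ((i : ℕ) / m) + 1) - φ (G.groupInDegree m ((i : ℕ) / m))) := by
  have hi : (i : ℕ) / m ∈ Finset.range n :=
    Finset.mem_range.2 (Nat.div_lt_of_lt_mul (by have := i.2; rw [mul_comm]; omega))
  have h : ∀ g, φ ((G.addVertex i).groupInDegree m g) - φ 0
      = (φ (G.groupInDegree m g) - φ 0)
        + if (i : ℕ) / m = g then φ (G.groupInDegree m g + 1) - φ (G.groupInDegree m g)
          else 0 := by
    intro g
    rw [Multidigraph.groupInDegree_addVertex]
    split_ifs <;> simp
  simp only [degreeDeviation, h, Finset.sum_add_distrib, Finset.sum_ite_eq, if_pos hi]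
  push_cast
  ring

/-- Only the group in progress at time `t` can contribute to this sum: later groups have in-degree
`0`, and at most `m` indices are left in the current one. -/
theorem abs_sum_unfinished_le {m n t : ℕ} {D : ℕ → ℝ} (hD : ∀ j, |D j| ≤ 1)
    (G : Multidigraph t t) :
    |∑ i ∈ Finset.Ico (t + 1) (n * m), (D 0 - D (G.groupInDegree m (i / m)))| ≤ 2 * m := by
  have hterm : ∀ i ∈ Finset.Ico (t + 1) (n * m),
      |D 0 - D (G.groupInDegree m (i / m))| ≤ if i < t + 1 + m then 2 else 0 := by
    intro i hi
    split_ifs with h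
    · have h0 := abs_le.1 (hD 0)
      have h1 := abs_le.1 (hD (G.groupInDegree m (i / m)))
      rw [abs_le]
      constructor <;> linarith
    · have hm : 0 < m := by
        rcases Nat.eq_zero_or_pos m with rfl | hm
        · simp at hi
        · exact hm
      have : t / m < i / m := by
        calc t / m < (t + m) / m := by rw [Nat.add_div_right _ hm]; exact Nat.lt_succ_self _
          _ ≤ i / m := Nat.div_le_div_right (by omega)
      rw [G.groupInDegree_eq_zero this]
      simp
  calc _ ≤ ∑ i ∈ Finset.Ico (t + 1) (n * m), |D 0 - D (G.groupInDegree m (i / m))| :=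
        Finset.abs_sum_le_sum_abs _ _
    _ ≤ ∑ i ∈ Finset.Ico (t + 1) (n * m), if i < t + 1 + m then (2 : ℝ) else 0 :=
        Finset.sum_le_sum hterm
    _ ≤ ∑ i ∈ Finset.Ico (t + 1) (t + 1 + m), (2 : ℝ) := by
        rw [← Finset.sum_filter]
        refine Finset.sum_le_sum_of_subset_of_nonneg (fun i hi => ?_) fun _ _ _ => zero_le_two
        simp only [Finset.mem_filter, Finset.mem_Ico] at hi ⊢
        omega
    _ = 2 * m := by simp [mul_comm]

theorem sum_range_div {n m : ℕ} (F : ℕ → ℝ) :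
    ∑ i ∈ Finset.range (n * m), F (i / m) = m * ∑ g ∈ Finset.range n, F g := by
  induction n with
  | zero => simp
  | succ n ih =>
    rw [Nat.succ_mul, Finset.sum_range_add, ih, Finset.sum_range_succ, mul_add]
    congr 1
    rw [Finset.sum_congr rfl (g := fun _ => F n)]
    · simp
    · intro i hi
      have hi := Finset.mem_range.1 hi
      rw [mul_comm, Nat.mul_add_div (by omega), Nat.div_eq_of_lt hi, add_zero]

/-- The drift of the deviation is of order `1 / t`. Apart from the boundary terms `R` (the group in
progress), `Δ 0` and `φ' 0 - S`, everything cancels, because `φ` solves the backward equation of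
the degree of a group and the limiting proportions solve the stationary forward equation. -/
theorem drift_eq {m n d t : ℕ} (hm : 1 ≤ m) (ht : t < n * m) {φ φ' : ℕ → ℝ}
    (hrec : ∀ j : ℕ, φ j = φ' j + ((j : ℝ) + m) / (2 * t + 1) * (φ' (j + 1) - φ' j))
    (hd : φ' (d + 1) = 0) (G : Multidigraph t t) (hG : ∀ e, G.src e = e) :
    (∑ g ∈ Finset.range n, (φ' (G.groupInDegree m g) - φ' 0)
        + ((t : ℝ) + 1) / m * (φ' 0 - ∑ j ∈ Finset.range (d + 1), limitProportion m j * φ' j))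
      + ∑ i : Fin (t + 1), (attachWeight G i).toReal *
          (φ' (G.groupInDegree m ((i : ℕ) / m) + 1) - φ' (G.groupInDegree m ((i : ℕ) / m)))
      = degreeDeviation m n d φ G
        + (∑ i ∈ Finset.Ico (t + 1) (n * m), ((φ' (0 + 1) - φ' 0)
              - (φ' (G.groupInDegree m (i / m) + 1) - φ' (G.groupInDegree m (i / m))))
            + (φ' (0 + 1) - φ' 0)
            + (φ' 0 - ∑ j ∈ Finset.range (d + 1), limitProportion m j * φ' j) / m)
          / (2 * t + 1) := by
  have hm' : (m : ℝ) ≠ 0 := by positivity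
  have ht' : (2 * (t : ℝ) + 1) ≠ 0 := by positivity
  set D : ℕ → ℝ := fun j => φ' (j + 1) - φ' j with hD
  set S := ∑ j ∈ Finset.range (d + 1), limitProportion m j * φ' j with hS
  have hsub : ∀ j : ℕ, φ j = φ' j + ((j : ℝ) + m) / (2 * t + 1) * D j := hrec
  -- the sum over the limiting proportions
  have hS' : ∑ j ∈ Finset.range (d + 1), limitProportion m j * φ j
      = S + (2 * S - 2 * φ' 0) / (2 * t + 1) := by
    have := sum_limitProportion_mul_diff hm (d + 1) φ'
    rw [hd, mul_zero, add_zero, ← hS] at this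
    rw [← this, hS, Finset.sum_div, ← Finset.sum_add_distrib]
    refine Finset.sum_congr rfl fun j _ => ?_
    rw [hsub]
    ring
  -- the sum over the groups
  have hgroups : ∑ g ∈ Finset.range n, (φ (G.groupInDegree m g) - φ 0)
      = ∑ g ∈ Finset.range n, (φ' (G.groupInDegree m g) - φ' 0)
        + (∑ e : Fin t, D (G.groupInDegree m ((G.tgt e : ℕ) / m))
          + m * ∑ g ∈ Finset.range n, D (G.groupInDegree m g) - n * m * D 0) / (2 * t + 1) := by
    rw [← G.sum_groupInDegree_mul ht.le fun g => D (G.groupInDegree m g), Finset.mul_sum]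
    have : (n : ℝ) * m * D 0 = ∑ _g ∈ Finset.range n, m * D 0 := by simp; ring
    rw [this, ← Finset.sum_add_distrib, ← Finset.sum_sub_distrib, Finset.sum_div,
      ← Finset.sum_add_distrib]
    refine Finset.sum_congr rfl fun g _ => ?_
    rw [hsub, hsub 0]
    push_cast
    ring
  have hsplit : ∑ i ∈ Finset.Ico (t + 1) (n * m), (D 0 - D (G.groupInDegree m (i / m)))
      = ((n * m : ℝ) - (t + 1)) * D 0
        - (m * ∑ g ∈ Finset.range n, D (G.groupInDegree m g)
          - ∑ i ∈ Finset.range (t + 1), D (G.groupInDegree m (i / m))) := by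
    rw [← sum_range_div fun g => D (G.groupInDegree m g), Finset.sum_sub_distrib,
      Finset.sum_Ico_eq_sub _ (by omega : t + 1 ≤ n * m),
      Finset.sum_Ico_eq_sub _ (by omega : t + 1 ≤ n * m)]
    simp only [Finset.sum_const, Finset.card_range, nsmul_eq_mul]
    push_cast
    ring
  have hX := sum_attachWeight_mul m G hG fun g => D (G.groupInDegree m g)
  change _ + ∑ i : Fin (t + 1), (attachWeight G i).toReal * D (G.groupInDegree m ((i : ℕ) / m))
    = _ + (∑ i ∈ Finset.Ico (t + 1) (n * m), (D 0 - D (G.groupInDegree m (i / m))) + D 0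
      + (φ' 0 - S) / m) / (2 * t + 1)
  rw [hX, hsplit, degreeDeviation, hgroups, hS', hsub 0]
  push_cast
  field_simp
  ring

/-- The growth of the second moment of the deviation in one step is bounded: the increments are
bounded, and the drift is of order `1 / t` while the deviation is at most of order `t`. -/
theorem sum_attachWeight_mul_degreeDeviation_sq_le {m n d t : ℕ} (hm : 1 ≤ m) (ht : t < n * m)
    {φ φ' : ℕ → ℝ} (hφ : ∀ j, φ j ∈ Set.Icc (0 : ℝ) 1) (hφ' : ∀ j, φ' j ∈ Set.Icc (0 : ℝ) 1)
    (hrec : ∀ j : ℕ, φ j = φ' j + ((j : ℝ) + m) / (2 * t + 1) * (φ' (j + 1) - φ' j))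
    (hd : φ' (d + 1) = 0) (G : Multidigraph t t) (hG : ∀ e, G.src e = e) :
    ∑ i : Fin (t + 1), (attachWeight G i).toReal * degreeDeviation m n d φ' (G.addVertex i) ^ 2
      ≤ degreeDeviation m n d φ G ^ 2 + (2 * m + 4) ^ 2 := by
  have hm' : (1 : ℝ) ≤ m := by exact_mod_cast hm
  have ht' : (0 : ℝ) < 2 * t + 1 := by positivity
  have hD : ∀ j, |φ' (j + 1) - φ' j| ≤ 1 := fun j => by
    rw [abs_le]
    constructor <;> linarith [(hφ' j).1, (hφ' j).2, (hφ' (j + 1)).1, (hφ' (j + 1)).2]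
  have hdrift := drift_eq hm ht hrec hd G hG
  simp only [degreeDeviation_addVertex ht]
  set B := ∑ g ∈ Finset.range n, (φ' (G.groupInDegree m g) - φ' 0)
    + ((t : ℝ) + 1) / m * (φ' 0 - ∑ j ∈ Finset.range (d + 1), limitProportion m j * φ' j)
  set x : Fin (t + 1) → ℝ := fun i =>
    φ' (G.groupInDegree m ((i : ℕ) / m) + 1) - φ' (G.groupInDegree m ((i : ℕ) / m))
  set p : Fin (t + 1) → ℝ := fun i => (attachWeight G i).toReal
  have hp : ∑ i, p i = 1 := sum_attachWeight_toReal G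
  set E := ∑ i ∈ Finset.Ico (t + 1) (n * m), ((φ' (0 + 1) - φ' 0)
      - (φ' (G.groupInDegree m (i / m) + 1) - φ' (G.groupInDegree m (i / m))))
    + (φ' (0 + 1) - φ' 0)
    + (φ' 0 - ∑ j ∈ Finset.range (d + 1), limitProportion m j * φ' j) / m with hE
  have hEle : |E| ≤ 2 * m + 2 := by
    have h1 := abs_sum_unfinished_le (n := n) (m := m) (D := fun j => φ' (j + 1) - φ' j) hD G
    have h2 := hD 0
    have h3 : |(φ' 0 - ∑ j ∈ Finset.range (d + 1), limitProportion m j * φ' j) / m| ≤ 1 := by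
      have hS := sum_limitProportion_mul_mem_Icc hm (d + 1) hφ'
      rw [abs_div, abs_of_nonneg (by positivity : (0 : ℝ) ≤ m)]
      refine div_le_one_of_le₀ (le_trans ?_ hm') (by positivity)
      rw [abs_le]
      constructor <;> linarith [hS.1, hS.2, (hφ' 0).1, (hφ' 0).2]
    refine (abs_add_three _ _ _).trans ?_
    linarith
  have hvar : ∑ i, p i * x i ^ 2 ≤ 1 := by
    rw [← hp]
    refine Finset.sum_le_sum fun i _ => mul_le_of_le_one_right ENNReal.toReal_nonneg ?_
    rw [sq_le_one_iff_abs_le_one]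
    exact hD _
  have hexpand : ∑ i, p i * (B + x i) ^ 2
      = (B + ∑ i, p i * x i) ^ 2 + (∑ i, p i * x i ^ 2 - (∑ i, p i * x i) ^ 2) := by
    have : ∀ i, p i * (B + x i) ^ 2 = B ^ 2 * p i + 2 * B * (p i * x i) + p i * x i ^ 2 :=
      fun i => by ring
    simp only [this, Finset.sum_add_distrib, ← Finset.mul_sum, hp]
    ring
  have hdev := abs_degreeDeviation_le (d := d) hm ht.le hφ G
  set Y := degreeDeviation m n d φ G
  have hcross : 2 * Y * (E / (2 * t + 1)) ≤ 2 * (2 * m + 2) := by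
    calc 2 * Y * (E / (2 * t + 1)) = 2 * (Y / (2 * t + 1) * E) := by ring
      _ ≤ 2 * (1 * (2 * m + 2)) := by
        refine mul_le_mul_of_nonneg_left ((le_abs_self _).trans ?_) zero_le_two
        rw [abs_mul]
        refine mul_le_mul ?_ hEle (abs_nonneg _) zero_le_one
        rw [abs_div, abs_of_pos ht']
        exact div_le_one_of_le₀ (by linarith) ht'.le
      _ = _ := by ring
  have hsq : (E / (2 * t + 1)) ^ 2 ≤ (2 * m + 2) ^ 2 := by
    rw [sq_le_sq, abs_div, abs_of_pos ht', abs_of_nonneg (by positivity : (0 : ℝ) ≤ 2 * m + 2)]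
    refine (div_le_self (abs_nonneg _) ?_).trans hEle
    linarith [(Nat.cast_nonneg t : (0 : ℝ) ≤ t)]
  calc ∑ i, p i * (B + x i) ^ 2
      ≤ (B + ∑ i, p i * x i) ^ 2 + 1 := by
        rw [hexpand]; linarith [sq_nonneg (∑ i, p i * x i)]
    _ = Y ^ 2 + 2 * Y * (E / (2 * t + 1)) + (E / (2 * t + 1)) ^ 2 + 1 := by
        rw [hdrift]; ring
    _ ≤ Y ^ 2 + (2 * m + 4) ^ 2 := by nlinarith

/-! ### The backward equation -/

/-- The function `φ_t` at time `t = T - k` of the backward equation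
`φ_t j = φ_{t+1} j + (j + m) / (2 t + 1) * (φ_{t+1} (j + 1) - φ_{t+1} j)` with `φ_T` the
indicator of `d`. For `t ≥ d + m` it is the probability that a finished group with in-degree `j` at
time `t` has in-degree `d` at time `T`. The argument `k` counts steps backwards from `T`, and only
`k ≤ T` matters. -/
noncomputable def backward (m d T : ℕ) : ℕ → ℕ → ℝ
  | 0, j => if j = d then 1 else 0
  | k + 1, j => backward m d T k j
      + ((j : ℝ) + m) / (2 * (T - (k + 1) : ℕ) + 1) * (backward m d T k (j + 1) - backward m d T k j)

theorem backward_eq_zero {m d T : ℕ} (k : ℕ) : ∀ {j : ℕ}, d < j → backward m d T k j = 0 := by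
  induction k with
  | zero => intro j hj; simp [backward, hj.ne']
  | succ k ih => intro j hj; simp [backward, ih hj, ih (hj.trans (Nat.lt_succ_self j))]

/-- From time `d + m` on, the weights `(j + m) / (2 t + 1)` with `j ≤ d` are probabilities. -/
theorem backward_mem_Icc {m d T : ℕ} (k : ℕ) (hk : k = 0 ∨ d + m + k ≤ T) :
    ∀ j, backward m d T k j ∈ Set.Icc (0 : ℝ) 1 := by
  induction k with
  | zero => intro j; rw [backward]; split_ifs <;> simp
  | succ k ih =>
    intro j
    have hk : d + m + (k + 1) ≤ T := by omega
    rcases lt_or_ge d j with hj | hj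
    · rw [backward_eq_zero _ hj]; simp
    · obtain ⟨h0, h1⟩ := ih (by omega) j
      obtain ⟨h2, h3⟩ := ih (by omega) (j + 1)
      rw [backward]
      set w := ((j : ℝ) + m) / (2 * (T - (k + 1) : ℕ) + 1)
      have hw0 : 0 ≤ w := by positivity
      have hw1 : w ≤ 1 := by
        refine div_le_one_of_le₀ ?_ (by positivity)
        have : j + m ≤ 2 * (T - (k + 1)) + 1 := by omega
        exact_mod_cast this
      constructor <;> nlinarith

/-! ### The second moment of the number of vertices of given degree -/

/-- The second moment of the deviation at time `t`. -/
noncomputable def secondMoment (m n d : ℕ) (φ : ℕ → ℝ) (t : ℕ) : ℝ≥0∞ :=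
  ∑' G, prefAttachOne t G * ENNReal.ofReal (degreeDeviation m n d φ G ^ 2)

theorem PMF.tsum_bind_mul {α β : Type*} (p : PMF α) (q : α → PMF β) (f : β → ℝ≥0∞) :
    ∑' b, p.bind q b * f b = ∑' a, p a * ∑' b, q a b * f b := by
  simp only [PMF.bind_apply, ← ENNReal.tsum_mul_right, ← ENNReal.tsum_mul_left, mul_assoc]
  exact ENNReal.tsum_comm

theorem PMF.tsum_map_mul {α β : Type*} (p : PMF α) (g : α → β) (f : β → ℝ≥0∞) :
    ∑' b, p.map g b * f b = ∑' a, p a * f (g a) := by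
  rw [PMF.map, PMF.tsum_bind_mul]
  refine tsum_congr fun a => ?_
  rw [tsum_eq_single (g a)]
  · simp
  · intro b hb; simp [hb]

theorem PMF.tsum_mul_le_add {α : Type*} (p : PMF α) {f g : α → ℝ≥0∞} {c : ℝ≥0∞}
    (h : ∀ a ∈ p.support, f a ≤ g a + c) : ∑' a, p a * f a ≤ ∑' a, p a * g a + c := by
  calc ∑' a, p a * f a ≤ ∑' a, (p a * g a + p a * c) := by
        refine ENNReal.tsum_le_tsum fun a => ?_
        rw [← mul_add]
        by_cases ha : a ∈ p.support
        · gcongr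
          exact h a ha
        · simp [(p.apply_eq_zero_iff a).2 ha]
    _ = _ := by rw [ENNReal.tsum_add, ENNReal.tsum_mul_right, p.tsum_coe, one_mul]

theorem secondMoment_succ_le {m n d t : ℕ} (hm : 1 ≤ m) (ht : t < n * m) {φ φ' : ℕ → ℝ}
    (hφ : ∀ j, φ j ∈ Set.Icc (0 : ℝ) 1) (hφ' : ∀ j, φ' j ∈ Set.Icc (0 : ℝ) 1)
    (hrec : ∀ j : ℕ, φ j = φ' j + ((j : ℝ) + m) / (2 * t + 1) * (φ' (j + 1) - φ' j))
    (hd : φ' (d + 1) = 0) :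
    secondMoment m n d φ' (t + 1)
      ≤ secondMoment m n d φ t + ENNReal.ofReal ((2 * m + 4) ^ 2) := by
  rw [secondMoment, prefAttachOne, PMF.tsum_bind_mul]
  refine PMF.tsum_mul_le_add _ fun G hG => ?_
  rw [PMF.tsum_map_mul, tsum_fintype, ← ENNReal.ofReal_add (sq_nonneg _) (sq_nonneg _)]
  refine le_trans (le_of_eq ?_) (ENNReal.ofReal_le_ofReal
    (sum_attachWeight_mul_degreeDeviation_sq_le hm ht hφ hφ' hrec hd G
      (src_of_mem_support_prefAttachOne t G hG)))
  rw [ENNReal.ofReal_sum_of_nonneg fun i _ => mul_nonneg ENNReal.toReal_nonneg (sq_nonneg _)]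
  refine Finset.sum_congr rfl fun i _ => ?_
  rw [ENNReal.ofReal_mul ENNReal.toReal_nonneg, ← PMF.ofFintype_apply (sum_attachWeight G),
    ENNReal.ofReal_toReal (PMF.apply_ne_top _ i), attachLaw]

theorem secondMoment_le_trivial {m n d t : ℕ} (hm : 1 ≤ m) (ht : t ≤ n * m) {φ : ℕ → ℝ}
    (hφ : ∀ j, φ j ∈ Set.Icc (0 : ℝ) 1) :
    secondMoment m n d φ t ≤ ENNReal.ofReal ((2 * t) ^ 2) := by
  have := PMF.tsum_mul_le_add (prefAttachOne t) (g := 0)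
    (f := fun G => ENNReal.ofReal (degreeDeviation m n d φ G ^ 2))
    (c := ENNReal.ofReal ((2 * t) ^ 2)) fun G _ => by
      rw [Pi.zero_apply, zero_add]
      exact ENNReal.ofReal_le_ofReal (sq_le_sq.2 ((abs_degreeDeviation_le hm ht hφ G).trans
        (le_abs_self _)))
  simpa [secondMoment] using this

/-- The one-step bound is summed from time `d + m` on, where the backward function takes values in
`[0, 1]`; before that time the trivial bound is used. -/
theorem secondMoment_final_le {m : ℕ} (n d : ℕ) (hm : 1 ≤ m) :
    secondMoment m n d (backward m d (n * m) 0) (n * m)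
      ≤ ENNReal.ofReal ((2 * (d + m)) ^ 2 + n * m * (2 * m + 4) ^ 2) := by
  rcases lt_or_ge (n * m) (d + m) with h | h
  · refine (secondMoment_le_trivial hm le_rfl (backward_mem_Icc 0 (Or.inl rfl))).trans
      (ENNReal.ofReal_le_ofReal ?_)
    have : ((n * m : ℕ) : ℝ) ≤ d + m := by exact_mod_cast h.le
    have h2 : (2 * ((n * m : ℕ) : ℝ)) ^ 2 ≤ (2 * (d + m)) ^ 2 := by gcongr
    exact h2.trans (le_add_of_nonneg_right (by positivity))
  · have key : ∀ t, d + m ≤ t → t ≤ n * m →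
        secondMoment m n d (backward m d (n * m) (n * m - t)) t
          ≤ ENNReal.ofReal ((2 * (d + m)) ^ 2 + t * (2 * m + 4) ^ 2) := by
      intro t ht
      induction t, ht using Nat.le_induction with
      | base =>
        intro _
        refine (secondMoment_le_trivial hm h (backward_mem_Icc _ (by omega))).trans
          (ENNReal.ofReal_le_ofReal ?_)
        push_cast
        exact le_add_of_nonneg_right (by positivity)
      | succ t ht ih =>
        intro ht'
        have hk : n * m - t = (n * m - (t + 1)) + 1 := by omega
        have hrec : ∀ j : ℕ, backward m d (n * m) (n * m - t) j
            = backward m d (n * m) (n * m - (t + 1)) j + ((j : ℝ) + m) / (2 * t + 1)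
              * (backward m d (n * m) (n * m - (t + 1)) (j + 1)
                - backward m d (n * m) (n * m - (t + 1)) j) := by
          intro j
          have ht'' : n * m - (n * m - (t + 1) + 1) = t := by omega
          rw [hk, backward, ht'']
        refine (secondMoment_succ_le hm ht' (backward_mem_Icc _ (by omega))
          (backward_mem_Icc _ (by omega)) hrec
          (backward_eq_zero _ (Nat.lt_succ_self d))).trans ?_
        refine (add_le_add_left (ih (by omega)) _).trans ?_
        rw [← ENNReal.ofReal_add (by positivity) (by positivity)]
        refine ENNReal.ofReal_le_ofReal (le_of_eq ?_)
        push_cast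
        ring
    have := key (n * m) h le_rfl
    rwa [Nat.sub_self, Nat.cast_mul] at this

theorem degreeDeviation_final {m n d : ℕ} (hm : 1 ≤ m) (G : Multidigraph (n * m) (n * m)) :
    degreeDeviation m n d (backward m d (n * m) 0) G
      = G.collapse.numInDegree d - n * limitProportion m d := by
  have hm' : (m : ℝ) ≠ 0 := by positivity
  have hN : (G.collapse.numInDegree d : ℝ)
      = ∑ g ∈ Finset.range n, backward m d (n * m) 0 (G.groupInDegree m g) := by
    rw [Finset.sum_range]
    simp [Multidigraph.numInDegree, Multidigraph.inDegree_collapse, backward]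
  have hα : ∑ j ∈ Finset.range (d + 1), limitProportion m j * backward m d (n * m) 0 j
      = limitProportion m d := by
    simp [backward]
  rw [degreeDeviation, hα, Finset.sum_sub_distrib, ← hN]
  simp only [Finset.sum_const, Finset.card_range, nsmul_eq_mul]
  push_cast
  field_simp
  ring

/-- Chebyshev's inequality for the number of vertices of in-degree `d`. -/
theorem prefAttach_deviation_le {m : ℕ} (hm : 1 ≤ m) (n d : ℕ) {r : ℝ} (hr : 0 < r) :
    (prefAttach m n).toMeasure
        {G | r < |(G.numInDegree d : ℝ) - n * limitProportion m d|}
      ≤ ENNReal.ofReal (((2 * (d + m)) ^ 2 + n * m * (2 * m + 4) ^ 2) / r ^ 2) := by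
  rw [PMF.toMeasure_apply_eq_toOuterMeasure, prefAttach, PMF.toOuterMeasure_map_apply,
    PMF.toOuterMeasure_apply, ENNReal.ofReal_div_of_pos (by positivity),
    ENNReal.le_div_iff_mul_le (Or.inl (by simp; positivity)) (Or.inl ENNReal.ofReal_ne_top),
    ← ENNReal.tsum_mul_right]
  refine le_trans (ENNReal.tsum_le_tsum fun G => ?_) (secondMoment_final_le n d hm)
  by_cases hG : r < |degreeDeviation m n d (backward m d (n * m) 0) G|
  · rw [Set.indicator_of_mem (by simpa [degreeDeviation_final hm] using hG)]
    gcongr _ * ENNReal.ofReal ?_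
    rw [← sq_abs (degreeDeviation _ _ _ _ _)]
    gcongr
  · rw [Set.indicator_of_notMem (by simpa [degreeDeviation_final hm] using hG), zero_mul]
    exact zero_le

/-! ### The union bound over the degrees -/

/-- The event that all proportions in the range `1 ≤ d ≤ D` are close to their limits fails with
probability `O(n ^ (-1/2))` if `D ^ 14 ≤ n`. -/
theorem prefAttach_exists_deviation_le {m : ℕ} (hm : 1 ≤ m) {δ : ℝ} (hδ : 0 < δ) :
    ∃ K : ℝ, ∀ n D : ℕ, 1 ≤ n → D ^ 14 ≤ n →
      (prefAttach m n).toMeasure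
        {G | ∃ d ∈ Finset.Icc 1 D, δ * limitProportion m d <
          |(G.numInDegree d : ℝ) / n - limitProportion m d|}
        ≤ ENNReal.ofReal (K / √n) := by
  have hm' : (0 : ℝ) < m := by exact_mod_cast hm
  set c : ℝ := 2 * m / ((m + 2) * (m + 3))
  have hc : 0 < c := by positivity
  set K₀ : ℝ := (2 * (1 + m)) ^ 2 + m * (2 * m + 4) ^ 2
  refine ⟨K₀ / (δ * c) ^ 2, fun n D hn hD => ?_⟩
  have hn' : (0 : ℝ) < n := by exact_mod_cast hn
  have hD7 : (D : ℝ) ^ 7 ≤ √n := by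
    refine Real.le_sqrt_of_sq_le ?_
    rw [← pow_mul]
    exact_mod_cast hD
  have hterm : ∀ d ∈ Finset.Icc 1 D, (prefAttach m n).toMeasure
      {G | δ * limitProportion m d < |(G.numInDegree d : ℝ) / n - limitProportion m d|}
        ≤ ENNReal.ofReal (K₀ / (δ * c) ^ 2 * (D : ℝ) ^ 6 / n) := by
    intro d hd
    obtain ⟨hd1, hdD⟩ := Finset.mem_Icc.1 hd
    have hd0 : (1 : ℝ) ≤ d := by exact_mod_cast hd1
    have hdD' : (d : ℝ) ≤ D := by exact_mod_cast hdD
    have hd2 : (d : ℝ) ^ 2 ≤ n := by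
      have : d ^ 2 ≤ n := calc
        d ^ 2 ≤ d ^ 14 := Nat.pow_le_pow_right hd1 (by norm_num)
        _ ≤ D ^ 14 := Nat.pow_le_pow_left hdD 14
        _ ≤ n := hD
      exact_mod_cast this
    have hα := le_limitProportion hm hd1
    have hα0 : 0 < limitProportion m d := lt_of_lt_of_le (by positivity) hα
    have hset : {G : Multidigraph n (n * m) |
          δ * limitProportion m d < |(G.numInDegree d : ℝ) / n - limitProportion m d|}
        = {G | n * (δ * limitProportion m d)
          < |(G.numInDegree d : ℝ) - n * limitProportion m d|} := by
      ext G
      have : (G.numInDegree d : ℝ) - n * limitProportion m d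
          = n * ((G.numInDegree d : ℝ) / n - limitProportion m d) := by field_simp
      rw [Set.mem_ofPred_eq, Set.mem_ofPred_eq, this, abs_mul, abs_of_pos hn',
        mul_lt_mul_iff_right₀ hn']
    rw [hset]
    refine (prefAttach_deviation_le hm n d (by positivity)).trans (ENNReal.ofReal_le_ofReal ?_)
    have hnum : (2 * ((d : ℝ) + m)) ^ 2 + n * m * (2 * m + 4) ^ 2 ≤ K₀ * n := by
      have : (2 * ((d : ℝ) + m)) ^ 2 ≤ (2 * (1 + m)) ^ 2 * n := calc
        (2 * ((d : ℝ) + m)) ^ 2 ≤ (2 * ((1 + m) * d)) ^ 2 := by gcongr; nlinarith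
        _ = (2 * (1 + m)) ^ 2 * (d : ℝ) ^ 2 := by ring
        _ ≤ _ := by gcongr
      calc (2 * ((d : ℝ) + m)) ^ 2 + n * m * (2 * m + 4) ^ 2
          ≤ (2 * (1 + (m : ℝ))) ^ 2 * n + n * m * (2 * m + 4) ^ 2 := by gcongr
        _ = K₀ * n := by ring
    calc ((2 * ((d : ℝ) + m)) ^ 2 + n * m * (2 * m + 4) ^ 2)
          / (n * (δ * limitProportion m d)) ^ 2
        ≤ K₀ * n / (n * (δ * (c * (1 / (d : ℝ) ^ 3)))) ^ 2 := by gcongr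
      _ = K₀ / (δ * c) ^ 2 * (d : ℝ) ^ 6 / n := by field_simp
      _ ≤ _ := by gcongr
  have hset : {G : Multidigraph n (n * m) | ∃ d ∈ Finset.Icc 1 D, δ * limitProportion m d <
        |(G.numInDegree d : ℝ) / n - limitProportion m d|}
      = ⋃ d ∈ Finset.Icc 1 D, {G : Multidigraph n (n * m) | δ * limitProportion m d <
        |(G.numInDegree d : ℝ) / n - limitProportion m d|} := by
    ext G; simp
  rw [hset]
  refine (MeasureTheory.measure_biUnion_finset_le _ _).trans
    ((Finset.sum_le_sum hterm).trans ?_)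
  rw [Finset.sum_const, Nat.card_Icc, Nat.add_sub_cancel, nsmul_eq_mul,
    ← ENNReal.ofReal_natCast, ← ENNReal.ofReal_mul (Nat.cast_nonneg D)]
  refine ENNReal.ofReal_le_ofReal ?_
  calc (D : ℝ) * (K₀ / (δ * c) ^ 2 * (D : ℝ) ^ 6 / n)
      = K₀ / (δ * c) ^ 2 * (D : ℝ) ^ 7 / n := by ring
    _ ≤ K₀ / (δ * c) ^ 2 * √n / n := by gcongr
    _ = K₀ / (δ * c) ^ 2 / √n := by
      rw [mul_div_assoc, Real.sqrt_div_self', mul_one_div]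

/-- The concentration statement with relative error `δ`. -/
theorem tendsto_prefAttach_abs_sub_le {m : ℕ} (hm : 1 ≤ m) {ε δ : ℝ} (hε : 0 < ε) (hδ : 0 < δ) :
    Tendsto (fun n : ℕ => (prefAttach m n).toMeasure
        {G | ∀ d : ℕ, 1 ≤ d → (d : ℝ) ≤ (n : ℝ) ^ ((1 : ℝ) / 14 - ε) →
          |(G.numInDegree d : ℝ) / (n : ℝ) - limitProportion m d| ≤ δ * limitProportion m d})
      atTop (𝓝 1) := by
  obtain ⟨K, hK⟩ := prefAttach_exists_deviation_le hm hδ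
  have hlim : Tendsto (fun n : ℕ => 1 - ENNReal.ofReal (K / √n)) atTop (𝓝 1) := by
    have h : Tendsto (fun n : ℕ => K / √n) atTop (𝓝 0) :=
      Tendsto.const_div_atTop
        (Real.tendsto_sqrt_atTop.comp tendsto_natCast_atTop_atTop) K
    have := ENNReal.Tendsto.sub (tendsto_const_nhds (x := (1 : ℝ≥0∞)))
      (ENNReal.tendsto_ofReal h) (Or.inl ENNReal.one_ne_top)
    simpa using this
  refine tendsto_of_tendsto_of_tendsto_of_le_of_le' hlim tendsto_const_nhds ?_
    (Eventually.of_forall fun n => MeasureTheory.prob_le_one)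
  filter_upwards [eventually_ge_atTop 1] with n hn
  have hn' : (1 : ℝ) ≤ n := by exact_mod_cast hn
  set D := ⌊(n : ℝ) ^ ((1 : ℝ) / 14)⌋₊
  have hD : D ^ 14 ≤ n := by
    have h : (D : ℝ) ≤ (n : ℝ) ^ ((1 : ℝ) / 14) := Nat.floor_le (by positivity)
    have h2 : (D : ℝ) ^ 14 ≤ (n : ℝ) := calc
      (D : ℝ) ^ 14 ≤ ((n : ℝ) ^ ((1 : ℝ) / 14)) ^ (14 : ℕ) := by gcongr
      _ = n := by
        rw [← Real.rpow_natCast, ← Real.rpow_mul (by positivity)]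
        norm_num
    exact_mod_cast h2
  rw [tsub_le_iff_right]
  refine le_trans ?_ (add_le_add_right (hK n D hn hD) _)
  rw [← MeasureTheory.measure_univ (μ := (prefAttach m n).toMeasure)]
  refine le_trans (MeasureTheory.measure_mono fun G _ => ?_) (MeasureTheory.measure_union_le _ _)
  by_cases hG : ∀ d : ℕ, 1 ≤ d → (d : ℝ) ≤ (n : ℝ) ^ ((1 : ℝ) / 14 - ε) →
      |(G.numInDegree d : ℝ) / (n : ℝ) - limitProportion m d| ≤ δ * limitProportion m d
  · exact Or.inl hG
  · push Not at hG
    obtain ⟨d, hd1, hdn, hd⟩ := hG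
    refine Or.inr ⟨d, Finset.mem_Icc.2 ⟨hd1, Nat.le_floor (hdn.trans ?_)⟩, hd⟩
    exact Real.rpow_le_rpow_of_exponent_le hn' (by linarith)

theorem theorem1 (m : ℕ) (hm : 1 ≤ m) :
    (∃ c C : ℝ, 0 < c ∧ 0 < C ∧ ∀ ε : ℝ, 0 < ε →
      Tendsto (fun n : ℕ => (prefAttach m n).toMeasure
        {G | ∀ d : ℕ, 1 ≤ d → (d : ℝ) ≤ (n : ℝ) ^ ((1 : ℝ) / 14 - ε) →
          c * (1 / (d : ℝ) ^ 3) ≤ (G.numInDegree d : ℝ) / (n : ℝ) ∧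
          (G.numInDegree d : ℝ) / (n : ℝ) ≤ C * (1 / (d : ℝ) ^ 3)})
        atTop (𝓝 1)) ∧
    (∀ ε : ℝ, 0 < ε → ∀ δ : ℝ, 0 < δ →
      Tendsto (fun n : ℕ => (prefAttach m n).toMeasure
        {G | ∀ d : ℕ, 1 ≤ d → (d : ℝ) ≤ (n : ℝ) ^ ((1 : ℝ) / 14 - ε) →
          |(G.numInDegree d : ℝ) / (n : ℝ) - limitProportion m d| ≤ δ * limitProportion m d})
        atTop (𝓝 1)) := by
  refine ⟨?_, fun ε hε δ hδ => tendsto_prefAttach_abs_sub_le hm hε hδ⟩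
  have hm' : (0 : ℝ) < m := by exact_mod_cast hm
  -- relative error `1 / 2` turns the bounds on the limiting proportions into bounds on `N / n`
  refine ⟨1 / 2 * (2 * m / ((m + 2) * (m + 3))), 3 / 2 * (2 * m * (m + 1)), by positivity,
    by positivity, fun ε hε => ?_⟩
  refine tendsto_of_tendsto_of_tendsto_of_le_of_le
    (tendsto_prefAttach_abs_sub_le hm hε (by norm_num : (0 : ℝ) < 1 / 2)) tendsto_const_nhds
    (fun n => MeasureTheory.measure_mono fun G hG d hd1 hdn => ?_)
    fun n => MeasureTheory.prob_le_one
  have h := abs_le.1 (hG d hd1 hdn)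
  have h1 := le_limitProportion hm hd1
  have h2 := limitProportion_le m hd1
  constructor <;> linarith [h.1, h.2]
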